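/- Let $\zeta$ be the Riemann zeta function, continued meromorphically to $\mathbb{C}$. In the series below a product $(s-2k)\,\zeta(s+1-2k)$ with $s=2k$ is read as its limit value $\lim_{w\to 0} w\,\zeta(1+w)=1$. (i) Let $s\in\mathbb{C}$ with $\Re(s)>1$, let $c>0$, and let $x\in\mathbb{R}$ with $|x|\le 2c$. Then the three series below converge absolutely and $$s\sum_{n=1}^{\infty}\frac{1}{n^{s+1}}\cos\frac{n\pi x}{c}+\frac{\pi x}{c}\sum_{n=1}^{\infty}\frac{1}{n^{s}}\sin\frac{n\pi x}{c}=\sum_{k=0}^{\infty}(-1)^k\frac{s-2k}{(2k)!}\left(\frac{\pi x}{c}\right)^{2k}\zeta(s+1-2k).$$ (ii) For every complex $s\neq 0$ the series below converges absolutely and $$s\,(2^{s+1}-1)\,\zeta(s+1)=2^{s}\sum_{k=1}^{\infty}(-1)^{k-1}\frac{(s-2k)\,\pi^{2k}}{(2k)!}\,\zeta(s+1-2k);$$ hence, whenever moreover $2^{s+1}\neq 1$, $$\zeta(s+1)=\frac{2^{s}}{s\,(2^{s+1}-1)}\sum_{k=1}^{\infty}(-1)^{k-1}\frac{(s-2k)\,\pi^{2k}}{(2k)!}\,\zeta(s+1-2k).$$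 -/

import Mathlib

/-- The entire function `w ↦ w ζ(w + 1)`: at `w = 0`, where `ζ(w + 1)` has its simple pole of
residue `1`, it takes the limit value `1`. -/
noncomputable def mulZeta (w : ℂ) : ℂ :=
  if w = 0 then 1 else w * riemannZeta (w + 1)

/-- The value of `mulZeta` at `0` is the limit of `w ζ(w + 1)` there. -/
theorem tendsto_mul_riemannZeta_add_one :
    Filter.Tendsto (fun w : ℂ => w * riemannZeta (w + 1)) (nhdsWithin 0 {0}ᶜ)
      (nhds (mulZeta 0)) := by
  have h : Filter.Tendsto (fun w : ℂ => w + 1) (nhdsWithin 0 {0}ᶜ) (nhdsWithin 1 {1}ᶜ) := by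
    refine tendsto_nhdsWithin_iff.2 ⟨?_, ?_⟩
    · have : Continuous (fun w : ℂ => w + 1) := by fun_prop
      simpa using (this.tendsto 0).mono_left nhdsWithin_le_nhds
    · filter_upwards [self_mem_nhdsWithin] with w hw
      simpa using hw
  simpa [mulZeta, Function.comp_def] using riemannZeta_residue_one.comp h

/-- The term of index `k` of the series
`∑ (-1)^k (s - 2k) / (2k)! · θ^(2k) · ζ(s + 1 - 2k)`, where `(s - 2k) ζ(s + 1 - 2k)` is read as its
limit `1` when `s = 2k`. -/
noncomputable def zetaTerm (s : ℂ) (θ : ℝ) (k : ℕ) : ℂ :=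
  (-1) ^ k * mulZeta (s - 2 * k) / ((2 * k).factorial : ℂ) * (θ : ℂ) ^ (2 * k)

/-- The term of index `n + 1` of the series `∑ cos(n θ) / n^s`, `n ≥ 1`. -/
noncomputable def cosTerm (s : ℂ) (θ : ℝ) (n : ℕ) : ℂ :=
  (Real.cos ((n + 1) * θ) : ℂ) / ((n : ℂ) + 1) ^ s

/-- The term of index `n + 1` of the series `∑ sin(n θ) / n^s`, `n ≥ 1`. -/
noncomputable def sinTerm (s : ℂ) (θ : ℝ) (n : ℕ) : ℂ :=
  (Real.sin ((n + 1) * θ) : ℂ) / ((n : ℂ) + 1) ^ s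

open Complex

/-! Put `θ = πx/c = 2πu`. For `Re s < -1` the functional equation turns `(s - 2k) ζ(s + 1 - 2k)`
into a factor free of `k` times `Γ(2k + 1 - s) ζ(2k - s) / (2π)^(2k)`. Expanding `ζ(2k - s)` as a
Dirichlet series and summing over `k` first gives the even part of a binomial series, hence terms `m
(m ± u)^(s - 1)`. These assemble into Hurwitz zeta functions, and the functional equation of the
latter produces `cosZeta` and `sinZeta`.

For `0 < u < 1` both sides are entire in `s`, so the identity theorem gives all `s`
(`mul_cosZeta_add_mul_sinZeta_eq_tsum`). For `Re s > 1` continuity in `θ` adds the endpoints `0` and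
`2π`, and parity adds negative `θ`; this is (i). For (ii) take `θ = π`: the sines vanish, the
cosines give the alternating zeta series, and the identity theorem removes `Re s > 1`
(`tsum_zetaTerm_pi`). -/

theorem differentiable_mulZeta : Differentiable ℂ mulZeta := by
  have key : ∀ w : ℂ, w ≠ 0 → DifferentiableAt ℂ mulZeta w := by
    intro w hw
    have h : DifferentiableAt ℂ (fun w : ℂ => w * riemannZeta (w + 1)) w := by
      refine differentiableAt_id.mul ?_
      exact (differentiableAt_riemannZeta (by simpa using hw)).comp w
        (differentiableAt_id.add_const 1)
    refine h.congr_of_eventuallyEq ?_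
    filter_upwards [isOpen_ne.mem_nhds hw] with z hz
    simp [mulZeta, show z ≠ 0 from hz]
  intro w
  rcases eq_or_ne w 0 with rfl | hw
  · refine (analyticAt_of_differentiable_on_punctured_nhds_of_continuousAt ?_ ?_).differentiableAt
    · filter_upwards [self_mem_nhdsWithin] with z hz using key z hz
    · rw [continuousAt_iff_punctured_nhds]
      refine tendsto_mul_riemannZeta_add_one.congr' ?_
      filter_upwards [self_mem_nhdsWithin] with z hz
      simp [mulZeta, show z ≠ 0 from hz]
  · exact key w hw

/-! ### Functional equation for the terms -/

theorem mulZeta_of_re_lt_neg_one {w : ℂ} (hw : w.re < -1) :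
    mulZeta w = -2 * (2 * Real.pi) ^ w * Gamma (1 - w) * cos (Real.pi * w / 2)
      * riemannZeta (-w) := by
  have hw0 : w ≠ 0 := by rintro rfl; norm_num at hw
  have h := riemannZeta_one_sub (s := -w)
    (fun n hn => by
      have := congrArg re hn
      simp at this
      have : (0 : ℝ) ≤ n := n.cast_nonneg
      linarith)
    (fun h => by
      have := congrArg re h
      simp at this
      linarith)
  rw [mulZeta, if_neg hw0, show w + 1 = 1 - -w by ring, h,
    show 1 - w = -w + 1 by ring, Gamma_add_one _ (neg_ne_zero.2 hw0)]
  rw [show (Real.pi : ℂ) * -w / 2 = -(Real.pi * w / 2) by ring, Complex.cos_neg, neg_neg]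
  ring

/-- The shift of the cosine by `kπ` yields `(-1)^k`, which cancels the sign of the series. -/
theorem mulZeta_sub_two_mul {s : ℂ} {k : ℕ} (h : s.re + 1 < 2 * k) :
    (-1) ^ k * mulZeta (s - 2 * k) = -2 * (2 * Real.pi) ^ s * cos (Real.pi * s / 2)
      * (Gamma (2 * k + 1 - s) * riemannZeta (2 * k - s) / (2 * Real.pi) ^ (2 * k)) := by
  have hpi : (2 * Real.pi : ℂ) ≠ 0 := by simp [Real.pi_ne_zero]
  rw [mulZeta_of_re_lt_neg_one (by simp; linarith), cpow_sub _ _ hpi,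
    show (2 * k : ℂ) = ((2 * k : ℕ) : ℂ) by push_cast; ring, cpow_natCast,
    show (Real.pi : ℂ) * (s - ((2 * k : ℕ) : ℂ)) / 2 = Real.pi * s / 2 - k * Real.pi by
      push_cast; ring, Complex.cos_antiperiodic.sub_nat_mul_eq,
    show -(s - ((2 * k : ℕ) : ℂ)) = ((2 * k : ℕ) : ℂ) - s by ring,
    show 1 - (s - ((2 * k : ℕ) : ℂ)) = ((2 * k : ℕ) : ℂ) + 1 - s by ring]
  have h1 : ((-1 : ℂ) ^ k) * (-1) ^ k = 1 := by rw [← mul_pow]; simp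
  linear_combination (-2 * ((2 * Real.pi) ^ s / (2 * Real.pi) ^ (2 * k)) *
    Gamma (((2 * k : ℕ) : ℂ) + 1 - s) * cos (Real.pi * s / 2)
      * riemannZeta (((2 * k : ℕ) : ℂ) - s)) * h1

/-! ### Bounds, convergence and holomorphy of the series in `k` -/

theorem norm_Gamma_le_Gamma_re {z : ℂ} (hz : 0 < z.re) : ‖Gamma z‖ ≤ Real.Gamma z.re := by
  rw [Gamma_eq_integral hz, Real.Gamma_eq_integral hz, GammaIntegral]
  refine (MeasureTheory.norm_integral_le_integral_norm _).trans (le_of_eq ?_)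
  refine MeasureTheory.setIntegral_congr_fun measurableSet_Ioi fun x hx => ?_
  rw [norm_mul, norm_cpow_eq_rpow_re_of_pos hx]
  rw [norm_real, Real.norm_eq_abs, Real.abs_exp]
  simp

theorem norm_riemannZeta_le_tsum {z : ℂ} (hz : 2 ≤ z.re) :
    ‖riemannZeta z‖ ≤ ∑' n : ℕ, 1 / ((n : ℝ) + 1) ^ 2 := by
  have hs : Summable fun n : ℕ => 1 / ((n : ℝ) + 1) ^ 2 := by
    have := (summable_nat_add_iff 1).2 (Real.summable_one_div_nat_pow.2 (one_lt_two))
    simpa using this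
  rw [zeta_eq_tsum_one_div_nat_add_one_cpow (by linarith)]
  refine tsum_of_norm_bounded hs.hasSum fun n => ?_
  have h : ((n : ℂ) + 1) = ((n + 1 : ℝ) : ℂ) := by push_cast; ring
  rw [norm_div, norm_one, h, norm_cpow_eq_rpow_re_of_pos (by positivity)]
  gcongr
  rw [← Real.rpow_natCast]
  exact Real.rpow_le_rpow_of_exponent_le (by linarith [(n.cast_nonneg : (0 : ℝ) ≤ n)])
    (by simpa using hz)

/-- The factor of the bound for `zetaTerm` that does not depend on the index. -/
noncomputable def zetaTermBound (s : ℂ) : ℝ :=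
  ‖-2 * (2 * Real.pi : ℂ) ^ s * cos (Real.pi * s / 2)‖ * ∑' n : ℕ, 1 / ((n : ℝ) + 1) ^ 2

theorem zetaTermBound_nonneg (s : ℂ) : 0 ≤ zetaTermBound s :=
  mul_nonneg (norm_nonneg _) (tsum_nonneg fun n => by positivity)

theorem continuous_zetaTermBound : Continuous zetaTermBound := by
  unfold zetaTermBound
  have hpi : (2 * Real.pi : ℂ) ≠ 0 := by simp [Real.pi_ne_zero]
  have : Continuous fun s : ℂ => (2 * Real.pi : ℂ) ^ s :=
    continuous_const.cpow continuous_id (fun s => Or.inl (by simp [Real.pi_pos]))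
  fun_prop

theorem norm_zetaTerm_le {s : ℂ} {k : ℕ} (h : s.re + 2 ≤ 2 * k) (θ : ℝ) :
    ‖zetaTerm s θ k‖ ≤ zetaTermBound s *
      (Real.Gamma (2 * k + 1 - s.re) / (2 * k).factorial * (|θ| / (2 * Real.pi)) ^ (2 * k)) := by
  have hG : ‖Gamma (2 * k + 1 - s)‖ ≤ Real.Gamma (2 * k + 1 - s.re) := by
    have := norm_Gamma_le_Gamma_re (z := 2 * k + 1 - s) (by simp; linarith)
    simpa using this
  have hZ := norm_riemannZeta_le_tsum (z := 2 * k - s) (by simp; linarith)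
  rw [zetaTerm, mulZeta_sub_two_mul (by linarith), zetaTermBound]
  have hGpos : 0 ≤ Real.Gamma (2 * k + 1 - s.re) := (norm_nonneg _).trans hG
  rw [norm_mul, norm_div, norm_mul, norm_div, norm_mul (Gamma _), norm_natCast, norm_pow, norm_pow,
    norm_real, show ‖(2 * Real.pi : ℂ)‖ = 2 * Real.pi by simp [Real.pi_pos.le], Real.norm_eq_abs]
  calc _ ≤ ‖-2 * (2 * Real.pi : ℂ) ^ s * cos (Real.pi * s / 2)‖ *
        (Real.Gamma (2 * k + 1 - s.re) * (∑' n : ℕ, 1 / ((n : ℝ) + 1) ^ 2) /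
          (2 * Real.pi) ^ (2 * k)) / (2 * k).factorial * |θ| ^ (2 * k) := by gcongr
    _ = _ := by rw [div_pow]; ring

/-- The terms telescope: with `b n = Γ(n + 1 - σ) / Γ(n)`, each equals `(b n - b (n + 1)) / (σ -
1)`. This settles the endpoint `|θ| = 2π`, where no geometric decay is left. -/
theorem summable_Gamma_ratio {σ : ℝ} (hσ : 1 < σ) :
    Summable fun n : ℕ => Real.Gamma (n + 1 - σ) / n.factorial := by
  obtain ⟨N, hN⟩ := exists_nat_gt σ
  rw [← summable_nat_add_iff N]
  set b : ℕ → ℝ := fun n => Real.Gamma ((n + N : ℕ) + 1 - σ) / Real.Gamma (n + N : ℕ) with hb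
  have hN0 : (0 : ℝ) < N := by linarith
  have hpos : ∀ n : ℕ, (0 : ℝ) < (n + N : ℕ) + 1 - σ := fun n => by
    push_cast; linarith [(n.cast_nonneg : (0 : ℝ) ≤ n)]
  have hpos' : ∀ n : ℕ, (0 : ℝ) < (n + N : ℕ) := fun n => by
    push_cast; linarith [(n.cast_nonneg : (0 : ℝ) ≤ n)]
  have hbpos : ∀ n, 0 ≤ b n := fun n =>
    div_nonneg (Real.Gamma_pos_of_pos (hpos n)).le (Real.Gamma_pos_of_pos (hpos' n)).le
  have hstep : ∀ n, Real.Gamma ((n + N : ℕ) + 1 - σ) / (n + N).factorial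
      = (b n - b (n + 1)) / (σ - 1) := by
    intro n
    have h1 : Real.Gamma ((n + 1 + N : ℕ) + 1 - σ)
        = ((n + N : ℕ) + 1 - σ) * Real.Gamma ((n + N : ℕ) + 1 - σ) := by
      rw [← Real.Gamma_add_one (hpos n).ne']
      congr 1; push_cast; ring
    have h2 : Real.Gamma (n + 1 + N : ℕ) = (n + N : ℕ) * Real.Gamma (n + N : ℕ) := by
      rw [← Real.Gamma_add_one (hpos' n).ne']
      congr 1; push_cast; ring
    have h3 : ((n + N).factorial : ℝ) = (n + N : ℕ) * Real.Gamma (n + N : ℕ) := by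
      rw [← Real.Gamma_nat_eq_factorial, Real.Gamma_add_one (hpos' n).ne']
    have h4 : Real.Gamma (n + N : ℕ) ≠ 0 := (Real.Gamma_pos_of_pos (hpos' n)).ne'
    have h5 := (hpos' n).ne'
    have h6 : σ - 1 ≠ 0 := by linarith
    simp only [hb]
    rw [h1, h2, h3]
    field_simp
    ring
  refine summable_of_sum_range_le (c := b 0 / (σ - 1))
    (fun n => div_nonneg (Real.Gamma_pos_of_pos (hpos n)).le (by positivity)) fun n => ?_
  rw [Finset.sum_congr rfl fun i _ => hstep i, ← Finset.sum_div, Finset.sum_range_sub']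
  have : 0 < σ - 1 := by linarith
  gcongr
  linarith [hbpos n]

theorem summable_zetaTerm_of_one_lt_re {s : ℂ} (hs : 1 < s.re) {θ : ℝ} (hθ : |θ| ≤ 2 * Real.pi) :
    Summable (zetaTerm s θ) := by
  obtain ⟨K, hK⟩ := exists_nat_gt (s.re + 2)
  rw [← summable_nat_add_iff K]
  have h2 : Summable fun k : ℕ =>
      Real.Gamma (2 * (k + K : ℕ) + 1 - s.re) / (2 * (k + K)).factorial := by
    have := (summable_Gamma_ratio hs).comp_injective
      (i := fun k => 2 * (k + K)) (fun a b h => by simpa using h)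
    refine this.congr fun k => ?_
    simp
  refine Summable.of_norm_bounded (h2.mul_left (zetaTermBound s)) fun k => ?_
  have hk : s.re + 2 ≤ 2 * (k + K : ℕ) := by
    push_cast; linarith [(k.cast_nonneg : (0 : ℝ) ≤ k)]
  refine (norm_zetaTerm_le hk θ).trans ?_
  refine mul_le_mul_of_nonneg_left ?_ (zetaTermBound_nonneg s)
  refine mul_le_of_le_one_right (div_nonneg (Real.Gamma_pos_of_pos (by linarith)).le
    (by positivity)) (pow_le_one₀ (by positivity) ?_)
  exact (div_le_one (by positivity)).2 hθ

theorem differentiable_zetaTerm (θ : ℝ) (k : ℕ) : Differentiable ℂ fun s => zetaTerm s θ k := by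
  unfold zetaTerm
  have := differentiable_mulZeta.comp
    (differentiable_id.sub_const (2 * k : ℂ))
  simp only [Function.comp_def, id] at this
  fun_prop

theorem exists_zetaTerm_bound {θ : ℝ} (hθ : |θ| < 2 * Real.pi) (R : ℝ) :
    ∃ (K : ℕ) (v : ℕ → ℝ), Summable v ∧
      ∀ k, ∀ s ∈ Metric.ball (0 : ℂ) R, ‖zetaTerm s θ (k + K)‖ ≤ v k := by
  obtain ⟨N, hN⟩ := exists_nat_gt (R + 2)
  obtain ⟨C, hC⟩ := (isCompact_closedBall (0 : ℂ) R).exists_bound_of_continuousOn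
    continuous_zetaTermBound.continuousOn
  have hpi := Real.pi_pos
  set r := |θ| / (2 * Real.pi) with hr
  have hr0 : 0 ≤ r := by positivity
  have hr1 : r < 1 := (div_lt_one (by positivity)).2 hθ
  -- Since `|Re s| < N`, the Gamma ratio is at most `(2j + N)! / (2j)! = N! * choose (2j + N) N`
  -- with `j = k + N`, and `r < 1` beats this polynomial growth.
  have h1 : Summable fun k : ℕ =>
      C * (N.factorial * (((2 * (k + N) + N).choose N : ℝ) * r ^ (2 * (k + N)))) := by
    have := summable_choose_mul_geometric_of_norm_lt_one (R := ℝ) N (r := r)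
      (by rwa [Real.norm_eq_abs, abs_of_nonneg hr0])
    have := this.comp_injective (i := fun k => 2 * (k + N)) (fun a b h => by simpa using h)
    exact ((this.mul_left (N.factorial : ℝ)).mul_left C)
  refine ⟨N, _, h1, fun k s hs => ?_⟩
  have hsR : ‖s‖ < R := by simpa using hs
  have hre := (abs_le.1 (abs_re_le_norm s))
  have hk0 : (0 : ℝ) ≤ k := k.cast_nonneg
  have hk : s.re + 2 ≤ 2 * (k + N : ℕ) := by
    push_cast; linarith [hre.2]
  have hCs : zetaTermBound s ≤ C :=
    (le_abs_self _).trans (hC s (Metric.ball_subset_closedBall hs))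
  have hG : Real.Gamma (2 * (k + N : ℕ) + 1 - s.re) ≤ (2 * (k + N) + N).factorial := by
    rw [← Real.Gamma_nat_eq_factorial]
    refine Real.Gamma_strictMonoOn_Ici.monotoneOn ?_ ?_ ?_
    · simp only [Set.mem_Ici]; linarith
    · simp only [Set.mem_Ici]; push_cast
      linarith [norm_nonneg s]
    · push_cast; linarith [hre.1]
  refine (norm_zetaTerm_le hk θ).trans ?_
  refine mul_le_mul hCs ?_ (mul_nonneg (div_nonneg
    (Real.Gamma_pos_of_pos (by linarith)).le (by positivity)) (by positivity))
    ((zetaTermBound_nonneg s).trans hCs)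
  rw [← mul_assoc]
  refine mul_le_mul_of_nonneg_right ?_ (by positivity)
  rw [div_le_iff₀ (by positivity)]
  refine hG.trans (le_of_eq ?_)
  have := Nat.choose_mul_factorial_mul_factorial (n := 2 * (k + N) + N) (k := N) (by omega)
  rw [Nat.add_sub_cancel] at this
  rw [← this]; push_cast; ring

theorem summable_zetaTerm {θ : ℝ} (hθ : |θ| < 2 * Real.pi) (s : ℂ) : Summable (zetaTerm s θ) := by
  obtain ⟨K, v, hv, h⟩ := exists_zetaTerm_bound hθ (‖s‖ + 1)
  rw [← summable_nat_add_iff K]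
  exact Summable.of_norm_bounded hv fun k => h k s (by simp)

theorem differentiable_tsum_zetaTerm {θ : ℝ} (hθ : |θ| < 2 * Real.pi) :
    Differentiable ℂ fun s => ∑' k, zetaTerm s θ k := by
  intro s
  obtain ⟨K, v, hv, h⟩ := exists_zetaTerm_bound hθ (‖s‖ + 1)
  have hd := differentiableOn_tsum_of_summable_norm hv
    (fun k => (differentiable_zetaTerm θ (k + K)).differentiableOn) Metric.isOpen_ball h
  have hd' := (hd.differentiableAt (Metric.isOpen_ball.mem_nhds (by simp : s ∈ _)))
  have he : (fun s => ∑' k, zetaTerm s θ k) = fun s =>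
      (∑ k ∈ Finset.range K, zetaTerm s θ k) + ∑' k, zetaTerm s θ (k + K) := by
    ext z
    exact ((summable_zetaTerm hθ z).sum_add_tsum_nat_add K).symm
  rw [he]
  refine DifferentiableAt.add ?_ hd'
  exact DifferentiableAt.fun_sum fun k _ => (differentiable_zetaTerm θ k) s

/-! ### Binomial series and evaluation for `Re s < -1` -/

theorem Gamma_add_natCast_div_factorial {p : ℂ} (hp : 0 < p.re) (n : ℕ) :
    Gamma (n + p) / n.factorial = Gamma p * Ring.choose (p + n - 1) n := by
  have h : Gamma (n + p) = (ascPochhammer ℂ n).eval p * Gamma p := by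
    induction n with
    | zero => simp
    | succ n ih =>
      have hne : (n : ℂ) + p ≠ 0 := fun h => by
        have := congrArg re h
        simp at this
        linarith [(n.cast_nonneg : (0 : ℝ) ≤ n)]
      rw [ascPochhammer_succ_eval, show ((n + 1 : ℕ) : ℂ) + p = (n + p) + 1 by push_cast; ring,
        Gamma_add_one _ hne, ih]
      ring
  have h2 := Ring.factorial_nsmul_multichoose_eq_ascPochhammer p n
  rw [Polynomial.ascPochhammer_smeval_eq_eval, Ring.multichoose_eq, nsmul_eq_mul] at h2
  have hf : (n.factorial : ℂ) ≠ 0 := by exact_mod_cast n.factorial_ne_zero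
  rw [h, ← h2]
  field_simp

theorem hasSum_Gamma_mul_pow {p z : ℂ} (hp : 0 < p.re) (hz : ‖z‖ < 1) :
    HasSum (fun n : ℕ => Gamma (n + p) / n.factorial * z ^ n) (Gamma p * (1 / (1 - z) ^ p)) := by
  have h := (one_div_one_sub_cpow_hasFPowerSeriesOnBall_zero p).hasSum
    (y := z) (by simpa [enorm_eq_nnnorm, ← NNReal.coe_lt_coe] using hz)
  simp only [FormalMultilinearSeries.ofScalars_apply_eq, zero_add, smul_eq_mul] at h
  refine (h.mul_left (Gamma p)).congr_fun fun n => ?_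
  rw [Gamma_add_natCast_div_factorial hp]
  ring

theorem hasSum_Gamma_mul_pow_even {p z : ℂ} (hp : 0 < p.re) (hz : ‖z‖ < 1) :
    HasSum (fun k : ℕ => Gamma (2 * k + p) / (2 * k).factorial * z ^ (2 * k))
      (Gamma p * ((1 / (1 - z) ^ p + 1 / (1 + z) ^ p) / 2)) := by
  have h := ((hasSum_Gamma_mul_pow hp hz).add
    (hasSum_Gamma_mul_pow (z := -z) hp (by simpa using hz))).div_const 2
  rw [sub_neg_eq_add, ← mul_add, mul_div_assoc] at h
  have hinj : Function.Injective fun k : ℕ => 2 * k := fun a b h => by simpa using h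
  rw [← hinj.hasSum_iff] at h
  · refine h.congr_fun fun k => ?_
    simp only [Function.comp_apply, (even_two_mul k).neg_pow]
    push_cast
    ring
  · intro n hn
    have : Odd n := by
      rw [← Nat.not_even_iff_odd, even_iff_exists_two_mul]
      rintro ⟨c, rfl⟩
      exact hn ⟨c, rfl⟩
    simp only [this.neg_pow]
    ring

-- Subtracting `u` times the odd series turns `|n + u|^s` into `|n| |n + u|^(s - 1)`. The term `n =
-- 0` thus vanishes, and `n = ±m` give `m^s (1 ± u/m)^(s - 1)`.
open HurwitzZeta in
theorem hasSum_hurwitzZetaEven_sub_mul_hurwitzZetaOdd {u : ℝ} (hu0 : 0 < u) (hu1 : u < 1) {s : ℂ}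
    (hs : s.re < -1) :
    HasSum (fun m : ℕ => ((m : ℂ) + 1) ^ s * ((1 / (1 - (u / (m + 1) : ℂ)) ^ (1 - s)
        + 1 / (1 + (u / (m + 1) : ℂ)) ^ (1 - s)) / 2))
      (hurwitzZetaEven u (-s) - u * hurwitzZetaOdd u (1 - s)) := by
  have h := ((hasSum_int_hurwitzZetaEven u (s := -s) (by simp; linarith)).sub
    ((hasSum_int_hurwitzZetaOdd u (s := 1 - s) (by simp; linarith)).mul_left (u : ℂ))).nat_add_neg
  have hu : (u : ℂ) ≠ 0 := by exact_mod_cast hu0.ne'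
  have hT0 : 1 / (u : ℂ) ^ (-s) = u * (1 / (u : ℂ) ^ (1 - s)) := by
    rw [sub_eq_add_neg, cpow_add _ _ hu, cpow_one]
    field_simp
  have hu' := abs_of_pos hu0
  rw [← hasSum_nat_add_iff' 1] at h
  simp only [Finset.range_one, Finset.sum_singleton, Nat.cast_zero, Int.cast_zero, neg_zero,
    zero_add, hu', sign_pos hu0, SignType.coe_one] at h
  have hz : 1 / (u : ℂ) ^ (-s) / 2 - u * (1 / (u : ℂ) ^ (1 - s) / 2) = 0 := by
    rw [hT0]; ring
  simp only [hz, add_zero, sub_zero] at h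
  refine h.congr_fun fun m => ?_
  have hm0 : (0 : ℝ) ≤ m := m.cast_nonneg
  set x : ℝ := m + 1 with hx
  have hxpos : 0 < x := by positivity
  have hp : 0 < x + u := by positivity
  have hq : 0 < x - u := by linarith
  have e1 : (((m + 1 : ℕ) : ℤ) : ℝ) + u = x + u := by push_cast; ring
  have e2 : ((-((m + 1 : ℕ) : ℤ) : ℤ) : ℝ) + u = -(x - u) := by push_cast; ring
  have e3 : (m : ℂ) + 1 = (x : ℂ) := by rw [hx]; push_cast; ring
  simp only [e1, e2, abs_neg, abs_of_pos hp, abs_of_pos hq, Left.sign_neg, sign_pos hp, sign_pos hq,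
    SignType.coe_one, SignType.coe_neg, e3]
  have hxc : (x : ℂ) ≠ 0 := by exact_mod_cast hxpos.ne'
  have hpc : ((x + u : ℝ) : ℂ) ≠ 0 := by exact_mod_cast hp.ne'
  have hqc : ((x - u : ℝ) : ℂ) ≠ 0 := by exact_mod_cast hq.ne'
  have f : ∀ y : ℝ, 0 < y → (x : ℂ) ^ s * (1 / ((y / x : ℝ) : ℂ) ^ (1 - s))
      = x / (y : ℂ) ^ (1 - s) := by
    intro y hy
    have hyc : (y : ℂ) ≠ 0 := by exact_mod_cast hy.ne'
    have : (y : ℂ) ^ (1 - s) ≠ 0 := by simp [cpow_eq_zero_iff, hyc]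
    have hxs : (x : ℂ) ^ (1 - s) ≠ 0 := by simp [cpow_eq_zero_iff, hxc]
    have hxx : (x : ℂ) ^ s * (x : ℂ) ^ (1 - s) = x := by
      rw [← cpow_add _ _ hxc]; simp
    have hdiv : ((y / x : ℝ) : ℂ) ^ (1 - s) = (y : ℂ) ^ (1 - s) / (x : ℂ) ^ (1 - s) := by
      rw [eq_div_iff hxs, ← mul_cpow_ofReal_nonneg (by positivity) hxpos.le, ← ofReal_mul,
        div_mul_cancel₀ _ hxpos.ne']
    rw [hdiv, one_div_div, ← mul_div_assoc, hxx]
  have g : ∀ y : ℂ, y ≠ 0 → 1 / y ^ (-s) = y / y ^ (1 - s) := by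
    intro y hy
    rw [sub_eq_add_neg, cpow_add _ _ hy, cpow_one]
    field_simp
  have e4 : 1 - (u / x : ℂ) = (((x - u) / x : ℝ) : ℂ) := by
    push_cast; field_simp
  have e5 : 1 + (u / x : ℂ) = (((x + u) / x : ℝ) : ℂ) := by
    push_cast; field_simp
  rw [e4, e5, ← mul_div_assoc, mul_add, f _ hp, f _ hq, g _ hpc, g _ hqc]
  push_cast
  ring

theorem tsum_zetaTerm_of_re_lt_neg_one {u : ℝ} (hu0 : 0 < u) (hu1 : u < 1) {s : ℂ}
    (hs : s.re < -1) :
    ∑' k, zetaTerm s (2 * Real.pi * u) k = -2 * (2 * Real.pi) ^ s * cos (Real.pi * s / 2)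
      * (Gamma (1 - s) *
        (HurwitzZeta.hurwitzZetaEven u (-s) - u * HurwitzZeta.hurwitzZetaOdd u (1 - s))) := by
  have hp : 0 < (1 - s).re := by simp; linarith
  have hpi : (2 * Real.pi : ℂ) ≠ 0 := by simp [Real.pi_ne_zero]
  set c : ℕ → ℂ := fun k => Gamma (2 * k + (1 - s)) / (2 * k).factorial with hc
  set F : ℕ → ℕ → ℂ := fun m k =>
    c k * ((u : ℂ) / (m + 1)) ^ (2 * k) * ((m : ℂ) + 1) ^ s with hF
  have hm : ∀ m : ℕ, ‖(u : ℂ) / (m + 1)‖ ≤ u := by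
    intro m
    have : (m : ℂ) + 1 = ((m + 1 : ℝ) : ℂ) := by push_cast; ring
    rw [this, ← ofReal_div, norm_real, Real.norm_eq_abs, abs_of_pos (by positivity)]
    exact div_le_self hu0.le (by linarith [(m.cast_nonneg : (0 : ℝ) ≤ m)])
  have hcol : ∀ m, HasSum (F m) (Gamma (1 - s) * (((m : ℂ) + 1) ^ s *
      ((1 / (1 - (u / (m + 1) : ℂ)) ^ (1 - s) + 1 / (1 + (u / (m + 1) : ℂ)) ^ (1 - s)) / 2))) := by
    intro m
    have := (hasSum_Gamma_mul_pow_even hp ((hm m).trans_lt hu1)).mul_right (((m : ℂ) + 1) ^ s)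
    rwa [mul_right_comm, mul_assoc (Gamma _)] at this
  have hzs : ∀ w : ℂ, 1 < w.re → HasSum (fun m : ℕ => 1 / ((m : ℂ) + 1) ^ w) (riemannZeta w) := by
    intro w hw
    rw [zeta_eq_tsum_one_div_nat_add_one_cpow hw]
    have := (summable_nat_add_iff 1).2 (summable_one_div_nat_cpow.2 hw)
    simpa using this.hasSum
  have hrow : ∀ k, HasSum (fun m => F m k) (c k * (u : ℂ) ^ (2 * k) * riemannZeta (2 * k - s)) := by
    intro k
    have := (hzs (2 * k - s) (by simp; linarith [(k.cast_nonneg : (0 : ℝ) ≤ k)])).mul_left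
      (c k * (u : ℂ) ^ (2 * k))
    refine this.congr_fun fun m => ?_
    have hm0 : (m : ℂ) + 1 ≠ 0 := Nat.cast_add_one_ne_zero m
    have hms : ((m : ℂ) + 1) ^ s ≠ 0 := by simp [cpow_eq_zero_iff, hm0]
    rw [cpow_sub _ _ hm0, show (2 * k : ℂ) = ((2 * k : ℕ) : ℂ) by push_cast; ring, cpow_natCast]
    simp only [hF, div_pow]
    field_simp
  -- As `u / (m + 1) ≤ u`, the double series is dominated by a product of two convergent series,
  -- which permits the interchange.
  have hsum : Summable (Function.uncurry F) := by
    have h1 : Summable fun k => ‖c k * (u : ℂ) ^ (2 * k)‖ :=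
      (hasSum_Gamma_mul_pow_even (z := (u : ℂ)) hp
        (by simpa [abs_of_pos hu0] using hu1)).summable.norm
    have h2 : Summable fun m : ℕ => ‖((m : ℂ) + 1) ^ s‖ := by
      have := (hzs (-s) (by simp; linarith)).summable.norm
      simpa [cpow_neg] using this
    refine Summable.of_norm_bounded
      (h2.mul_of_nonneg h1 (fun _ => norm_nonneg _) fun _ => norm_nonneg _) ?_
    rintro ⟨m, k⟩
    simp only [Function.uncurry, hF]
    rw [norm_mul, norm_mul, norm_mul, mul_comm (‖c k‖ * _), norm_pow, norm_pow]
    gcongr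
    simpa [abs_of_pos hu0] using hm m
  have hcomm := hsum.tsum_comm
  rw [tsum_congr fun k => (hrow k).tsum_eq, tsum_congr fun m => (hcol m).tsum_eq, tsum_mul_left,
    (hasSum_hurwitzZetaEven_sub_mul_hurwitzZetaOdd hu0 hu1 hs).tsum_eq] at hcomm
  rw [← hcomm, ← tsum_mul_left]
  refine tsum_congr fun k => ?_
  rw [zetaTerm, mulZeta_sub_two_mul (by linarith [(k.cast_nonneg : (0 : ℝ) ≤ k)])]
  simp only [hc]
  rw [show 2 * (k : ℂ) + 1 - s = 2 * k + (1 - s) by ring]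
  push_cast
  rw [mul_pow (2 * Real.pi : ℂ)]
  field_simp

/-! ### Analytic continuation in `s` -/

open HurwitzZeta in
theorem mul_cosZeta_add_mul_sinZeta_eq_tsum {u : ℝ} (hu0 : 0 < u) (hu1 : u < 1) (s : ℂ) :
    s * cosZeta u (s + 1) + (2 * Real.pi * u : ℝ) * sinZeta u s
      = ∑' k, zetaTerm s (2 * Real.pi * u) k := by
  have hpi := Real.pi_pos
  -- Away from the trivial class `cosZeta` has no pole, so the left side is entire.
  have hu : (u : UnitAddCircle) ≠ 0 := by
    rw [Ne, AddCircle.coe_eq_zero_iff]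
    rintro ⟨n, hn⟩
    rw [zsmul_one] at hn
    rw [← hn] at hu0 hu1
    have h0 : 0 < n := by exact_mod_cast hu0
    have h1 : n < 1 := by exact_mod_cast hu1
    omega
  have hθ : |2 * Real.pi * u| < 2 * Real.pi := by
    rw [abs_of_pos (by positivity)]
    exact mul_lt_of_lt_one_right (by positivity) hu1
  have hL : Differentiable ℂ fun s : ℂ =>
      s * cosZeta u (s + 1) + (2 * Real.pi * u : ℝ) * sinZeta u s := by
    have h1 := (differentiable_cosZeta_of_ne_zero hu).comp (differentiable_id.add_const (1 : ℂ))
    have h2 := differentiableAt_sinZeta (u : UnitAddCircle)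
    simp only [Function.comp_def, id] at h1
    fun_prop
  have hR := differentiable_tsum_zetaTerm hθ
  have hfun := (hL.differentiableOn.analyticOnNhd isOpen_univ).eq_of_eventuallyEq
    (hR.differentiableOn.analyticOnNhd isOpen_univ) (z₀ := -2) ?_
  · exact congrFun hfun s
  have hopen : IsOpen {z : ℂ | z.re < -1} := isOpen_lt continuous_re continuous_const
  filter_upwards [hopen.mem_nhds (by simp : (-2 : ℂ) ∈ _)] with z hz
  have hz : z.re < -1 := hz
  have hpic : (2 * Real.pi : ℂ) ≠ 0 := by simp [Real.pi_ne_zero]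
  have hc := cosZeta_one_sub u (s := -z) (fun n h => by
    have := congrArg re h
    simp at this
    linarith [(n.cast_nonneg : (0 : ℝ) ≤ n)])
  have hsn := sinZeta_one_sub u (s := 1 - z) (fun n h => by
    have := congrArg re h
    simp at this
    linarith [(n.cast_nonneg : (0 : ℝ) ≤ n)])
  have hz0 : z ≠ 0 := by rintro rfl; norm_num at hz
  rw [tsum_zetaTerm_of_re_lt_neg_one hu0 hu1 hz, show z + 1 = 1 - -z by ring, hc,
    show sinZeta u z = sinZeta u (1 - (1 - z)) by rw [sub_sub_cancel], hsn,
    show (Real.pi : ℂ) * -z / 2 = -(Real.pi * z / 2) by ring, Complex.cos_neg,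
    show (Real.pi : ℂ) * (1 - z) / 2 = Real.pi / 2 - Real.pi * z / 2 by ring,
    Complex.sin_pi_div_two_sub, show 1 - z = -z + 1 by ring, Gamma_add_one _ (neg_ne_zero.2 hz0),
    neg_neg, show -(-z + 1) = z - 1 by ring, cpow_sub _ _ hpic, cpow_one]
  push_cast
  field_simp
  ring

/-! ### Trigonometric series for `Re s > 1` and the closed range of `θ` -/

theorem norm_natCast_add_one_cpow (n : ℕ) (s : ℂ) :
    ‖((n : ℂ) + 1) ^ s‖ = ((n : ℝ) + 1) ^ s.re := by
  have h : ((n : ℂ) + 1) = ((n + 1 : ℝ) : ℂ) := by push_cast; ring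
  rw [h, norm_cpow_eq_rpow_re_of_pos (by positivity)]

theorem summable_one_div_add_one_rpow {σ : ℝ} (hσ : 1 < σ) :
    Summable fun n : ℕ => 1 / ((n : ℝ) + 1) ^ σ := by
  have := (summable_nat_add_iff 1).2 (Real.summable_one_div_nat_rpow.2 hσ)
  simpa using this

theorem norm_cosTerm_le (s : ℂ) (θ : ℝ) (n : ℕ) :
    ‖cosTerm s θ n‖ ≤ 1 / ((n : ℝ) + 1) ^ s.re := by
  rw [cosTerm, norm_div, norm_natCast_add_one_cpow, norm_real]
  gcongr
  exact Real.abs_cos_le_one _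

theorem norm_sinTerm_le (s : ℂ) (θ : ℝ) (n : ℕ) :
    ‖sinTerm s θ n‖ ≤ 1 / ((n : ℝ) + 1) ^ s.re := by
  rw [sinTerm, norm_div, norm_natCast_add_one_cpow, norm_real]
  gcongr
  exact Real.abs_sin_le_one _

theorem summable_cosTerm {s : ℂ} (hs : 1 < s.re) (θ : ℝ) : Summable (cosTerm s θ) :=
  Summable.of_norm_bounded (summable_one_div_add_one_rpow hs) (norm_cosTerm_le s θ)

theorem summable_sinTerm {s : ℂ} (hs : 1 < s.re) (θ : ℝ) : Summable (sinTerm s θ) :=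
  Summable.of_norm_bounded (summable_one_div_add_one_rpow hs) (norm_sinTerm_le s θ)

theorem continuous_tsum_cosTerm {s : ℂ} (hs : 1 < s.re) :
    Continuous fun θ => ∑' n, cosTerm s θ n := by
  refine continuous_tsum (fun n => ?_) (summable_one_div_add_one_rpow hs)
    fun n θ => norm_cosTerm_le s θ n
  unfold cosTerm
  fun_prop

theorem continuous_tsum_sinTerm {s : ℂ} (hs : 1 < s.re) :
    Continuous fun θ => ∑' n, sinTerm s θ n := by
  refine continuous_tsum (fun n => ?_) (summable_one_div_add_one_rpow hs)
    fun n θ => norm_sinTerm_le s θ n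
  unfold sinTerm
  fun_prop

theorem continuousOn_tsum_zetaTerm {s : ℂ} (hs : 1 < s.re) :
    ContinuousOn (fun θ => ∑' k, zetaTerm s θ k) (Set.Icc 0 (2 * Real.pi)) := by
  have hpi := Real.pi_pos
  -- The norms at `θ = 2π` majorize those on the whole interval.
  have h := summable_zetaTerm_of_one_lt_re hs (θ := 2 * Real.pi) (abs_of_pos (by positivity)).le
  refine continuousOn_tsum (fun k => ?_) h.norm fun k θ hθ => ?_
  · unfold zetaTerm
    fun_prop
  · simp only [zetaTerm, norm_mul, norm_pow, norm_real, Real.norm_eq_abs]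
    have h1 : |θ| ≤ |2 * Real.pi| := by
      rw [abs_of_nonneg hθ.1, abs_of_pos (by positivity)]
      exact hθ.2
    rw [abs_mul] at h1
    gcongr

theorem tsum_cosTerm_eq_cosZeta {s : ℂ} (hs : 1 < s.re) (u : ℝ) :
    ∑' n, cosTerm s (2 * Real.pi * u) n = HurwitzZeta.cosZeta u s := by
  have h := HurwitzZeta.hasSum_nat_cosZeta u hs
  rw [← hasSum_nat_add_iff' 1] at h
  simp only [Finset.range_one, Finset.sum_singleton, Nat.cast_zero,
    zero_cpow (ne_zero_of_one_lt_re hs), div_zero, sub_zero] at h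
  rw [← h.tsum_eq]
  refine tsum_congr fun n => ?_
  rw [cosTerm, mul_comm]
  push_cast
  rfl

theorem tsum_sinTerm_eq_sinZeta {s : ℂ} (hs : 1 < s.re) (u : ℝ) :
    ∑' n, sinTerm s (2 * Real.pi * u) n = HurwitzZeta.sinZeta u s := by
  have h := HurwitzZeta.hasSum_nat_sinZeta u hs
  rw [← hasSum_nat_add_iff' 1] at h
  simp only [Finset.range_one, Finset.sum_singleton, Nat.cast_zero,
    zero_cpow (ne_zero_of_one_lt_re hs), div_zero, sub_zero] at h
  rw [← h.tsum_eq]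
  refine tsum_congr fun n => ?_
  rw [sinTerm, mul_comm]
  push_cast
  rfl

theorem mul_tsum_cosTerm_add_mul_tsum_sinTerm_of_nonneg {s : ℂ} (hs : 1 < s.re) {θ : ℝ}
    (h0 : 0 ≤ θ) (h1 : θ ≤ 2 * Real.pi) :
    s * ∑' n, cosTerm (s + 1) θ n + θ * ∑' n, sinTerm s θ n = ∑' k, zetaTerm s θ k := by
  have hpi := Real.pi_pos
  have hs1 : 1 < (s + 1).re := by simp; linarith
  have heq : Set.EqOn
      (fun θ : ℝ => s * ∑' n, cosTerm (s + 1) θ n + θ * ∑' n, sinTerm s θ n)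
      (fun θ => ∑' k, zetaTerm s θ k) (Set.Ioo 0 (2 * Real.pi)) := by
    intro θ hθ
    have hu : 2 * Real.pi * (θ / (2 * Real.pi)) = θ := by field_simp
    have h := mul_cosZeta_add_mul_sinZeta_eq_tsum (u := θ / (2 * Real.pi))
      (div_pos hθ.1 (by positivity)) ((div_lt_one (by positivity)).2 hθ.2) s
    rw [← tsum_cosTerm_eq_cosZeta hs1, ← tsum_sinTerm_eq_sinZeta hs, hu] at h
    exact h
  refine heq.of_subset_closure (t := Set.Icc 0 (2 * Real.pi)) ?_ (continuousOn_tsum_zetaTerm hs)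
    Set.Ioo_subset_Icc_self ?_ ⟨h0, h1⟩
  · have hc := continuous_tsum_cosTerm hs1
    have hsn := continuous_tsum_sinTerm hs
    fun_prop
  · rw [closure_Ioo (by positivity)]

theorem mul_tsum_cosTerm_add_mul_tsum_sinTerm {s : ℂ} (hs : 1 < s.re) {θ : ℝ}
    (hθ : |θ| ≤ 2 * Real.pi) :
    s * ∑' n, cosTerm (s + 1) θ n + θ * ∑' n, sinTerm s θ n = ∑' k, zetaTerm s θ k := by
  rcases le_total 0 θ with h | h
  · exact mul_tsum_cosTerm_add_mul_tsum_sinTerm_of_nonneg hs h ((le_abs_self _).trans hθ)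
  · have := mul_tsum_cosTerm_add_mul_tsum_sinTerm_of_nonneg hs (θ := -θ) (by linarith)
      ((neg_le_abs _).trans hθ)
    have hc : cosTerm (s + 1) (-θ) = cosTerm (s + 1) θ := by
      ext n; simp only [cosTerm, mul_neg, Real.cos_neg]
    have hsn : sinTerm s (-θ) = -sinTerm s θ := by
      ext n; simp only [sinTerm, mul_neg, Real.sin_neg, ofReal_neg, neg_div, Pi.neg_apply]
    have hz : zetaTerm s (-θ) = zetaTerm s θ := by
      ext k; simp only [zetaTerm, ofReal_neg, (even_two_mul k).neg_pow]
    rw [hc, hsn, hz] at this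
    simp only [Pi.neg_apply, tsum_neg] at this
    rw [← this]
    push_cast
    ring

/-! ### The case `θ = π` and the conclusion -/

theorem HasSum.alternating_of_odd {f : ℕ → ℂ} {a b : ℂ} (hf : HasSum f a)
    (hodd : HasSum (fun n => f (2 * n + 1)) b) :
    HasSum (fun n => (-1) ^ (n + 1) * f n) (2 * b - a) := by
  have hinj : Function.Injective fun n : ℕ => 2 * n := fun a b h => by simpa using h
  obtain ⟨e, heven⟩ : ∃ e, HasSum (fun n => f (2 * n)) e :=
    ⟨_, (hf.summable.comp_injective hinj).hasSum⟩
  have htot := (heven.even_add_odd hodd).unique hf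
  rw [show 2 * b - a = -e + b by linear_combination htot]
  refine HasSum.even_add_odd (heven.neg.congr_fun fun n => ?_) (hodd.congr_fun fun n => ?_)
  · rw [pow_succ, (even_two_mul n).neg_one_pow]; ring
  · rw [show 2 * n + 1 + 1 = 2 * (n + 1) by ring, (even_two_mul (n + 1)).neg_one_pow, one_mul]

theorem tsum_cosTerm_pi {s : ℂ} (hs : 1 < s.re) :
    ∑' n, cosTerm s Real.pi n = (2 * 2 ^ (-s) - 1) * riemannZeta s := by
  have hz : HasSum (fun n : ℕ => 1 / ((n : ℂ) + 1) ^ s) (riemannZeta s) := by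
    rw [zeta_eq_tsum_one_div_nat_add_one_cpow hs]
    have := (summable_nat_add_iff 1).2 (summable_one_div_nat_cpow.2 hs)
    simpa using this.hasSum
  -- Index `n` stands for the integer `n + 1`, so odd indices carry the even integers.
  have hodd : HasSum (fun n : ℕ => 1 / (((2 * n + 1 : ℕ) : ℂ) + 1) ^ s)
      (2 ^ (-s) * riemannZeta s) := by
    refine (hz.mul_left _).congr_fun fun n => ?_
    have h1 : ((2 * n + 1 : ℕ) : ℂ) + 1 = ((2 : ℝ) : ℂ) * ((n + 1 : ℝ) : ℂ) := by
      push_cast; ring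
    have h2 : (n : ℂ) + 1 = ((n + 1 : ℝ) : ℂ) := by push_cast; ring
    rw [h1, h2, mul_cpow_ofReal_nonneg (by norm_num) (by positivity), cpow_neg, ofReal_ofNat,
      one_div, one_div, mul_inv]
  rw [show (2 * 2 ^ (-s) - 1) * riemannZeta s
    = 2 * (2 ^ (-s) * riemannZeta s) - riemannZeta s by ring]
  rw [← (hz.alternating_of_odd hodd).tsum_eq]
  refine tsum_congr fun n => ?_
  have h := Real.cos_nat_mul_pi (n + 1)
  rw [Nat.cast_add_one] at h
  rw [cosTerm, h, ofReal_pow, ofReal_neg, ofReal_one, mul_one_div]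

theorem tsum_zetaTerm_pi (s : ℂ) : ∑' k, zetaTerm s Real.pi k = (2 ^ (-s) - 1) * mulZeta s := by
  have hpi := Real.pi_pos
  have hθ : |Real.pi| < 2 * Real.pi := by rw [abs_of_pos hpi]; linarith
  have hL := differentiable_tsum_zetaTerm hθ
  have hR : Differentiable ℂ fun s : ℂ => ((2 : ℂ) ^ (-s) - 1) * mulZeta s := by
    have := differentiable_mulZeta
    have h2 : Differentiable ℂ fun s : ℂ => (2 : ℂ) ^ (-s) := fun s =>
      differentiableAt_id.neg.const_cpow (Or.inl two_ne_zero)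
    fun_prop
  have hfun := (hL.differentiableOn.analyticOnNhd isOpen_univ).eq_of_eventuallyEq
    (hR.differentiableOn.analyticOnNhd isOpen_univ) (z₀ := 2) ?_
  · exact congrFun hfun s
  have hopen : IsOpen {z : ℂ | 1 < z.re} := isOpen_lt continuous_const continuous_re
  filter_upwards [hopen.mem_nhds (by simp : (2 : ℂ) ∈ _)] with z hz
  have hz : 1 < z.re := hz
  have hz0 := ne_zero_of_one_lt_re hz
  have hsin : sinTerm z Real.pi = 0 := by
    ext n
    have := Real.sin_nat_mul_pi (n + 1)
    push_cast at this
    simp [sinTerm, this]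
  rw [← mul_tsum_cosTerm_add_mul_tsum_sinTerm hz hθ.le, tsum_cosTerm_pi (by simp; linarith), hsin,
    mulZeta, if_neg hz0, neg_add, cpow_add _ _ two_ne_zero, cpow_neg_one]
  simp
  ring

theorem theorem4p7 :
    (∀ (s : ℂ) (c x : ℝ), 1 < s.re → 0 < c → |x| ≤ 2 * c →
      Summable (cosTerm (s + 1) (Real.pi * x / c)) ∧
      Summable (sinTerm s (Real.pi * x / c)) ∧
      Summable (zetaTerm s (Real.pi * x / c)) ∧
      s * ∑' n : ℕ, cosTerm (s + 1) (Real.pi * x / c) n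
          + ((Real.pi * x / c : ℝ) : ℂ) * ∑' n : ℕ, sinTerm s (Real.pi * x / c) n
        = ∑' k : ℕ, zetaTerm s (Real.pi * x / c) k) ∧
    (∀ s : ℂ, s ≠ 0 →
      Summable (fun k : ℕ =>
        (-1 : ℂ) ^ k * mulZeta (s - 2 * ((k : ℂ) + 1)) * (Real.pi : ℂ) ^ (2 * (k + 1))
          / ((2 * (k + 1)).factorial : ℂ)) ∧
      s * ((2 : ℂ) ^ (s + 1) - 1) * riemannZeta (s + 1)
        = (2 : ℂ) ^ s * ∑' k : ℕ,
          (-1 : ℂ) ^ k * mulZeta (s - 2 * ((k : ℂ) + 1)) * (Real.pi : ℂ) ^ (2 * (k + 1))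
            / ((2 * (k + 1)).factorial : ℂ) ∧
      ((2 : ℂ) ^ (s + 1) ≠ 1 →
        riemannZeta (s + 1)
          = (2 : ℂ) ^ s / (s * ((2 : ℂ) ^ (s + 1) - 1)) * ∑' k : ℕ,
            (-1 : ℂ) ^ k * mulZeta (s - 2 * ((k : ℂ) + 1)) * (Real.pi : ℂ) ^ (2 * (k + 1))
              / ((2 * (k + 1)).factorial : ℂ))) := by
  have hpi := Real.pi_pos
  refine ⟨fun s c x hs hc hx => ?_, fun s hs => ?_⟩
  · have hθ : |Real.pi * x / c| ≤ 2 * Real.pi := by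
      rw [abs_div, abs_mul, abs_of_pos hpi, abs_of_pos hc, div_le_iff₀ hc]
      nlinarith
    exact ⟨summable_cosTerm (by simp; linarith) _, summable_sinTerm hs _,
      summable_zetaTerm_of_one_lt_re hs hθ, mul_tsum_cosTerm_add_mul_tsum_sinTerm hs hθ⟩
  · have hθ : |Real.pi| < 2 * Real.pi := by rw [abs_of_pos hpi]; linarith
    have hsum := summable_zetaTerm hθ s
    have hterm : (fun k : ℕ =>
        (-1 : ℂ) ^ k * mulZeta (s - 2 * ((k : ℂ) + 1)) * (Real.pi : ℂ) ^ (2 * (k + 1))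
          / ((2 * (k + 1)).factorial : ℂ)) = fun k => -zetaTerm s Real.pi (k + 1) := by
      ext k
      rw [zetaTerm, pow_succ (-1 : ℂ) k]
      push_cast
      ring
    have hmain : s * ((2 : ℂ) ^ (s + 1) - 1) * riemannZeta (s + 1)
        = (2 : ℂ) ^ s * ∑' k : ℕ,
          (-1 : ℂ) ^ k * mulZeta (s - 2 * ((k : ℂ) + 1)) * (Real.pi : ℂ) ^ (2 * (k + 1))
            / ((2 * (k + 1)).factorial : ℂ) := by
      -- Moving the `k = 0` term `s ζ(s + 1)` across changes `2^(-s) - 1` into `2^(-s) - 2`, and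
      -- multiplying by `-2^s` gives `2^(s + 1) - 1`.
      have h := hsum.tsum_eq_zero_add
      rw [tsum_zetaTerm_pi] at h
      have h0 : zetaTerm s Real.pi 0 = mulZeta s := by simp [zetaTerm]
      have hM : mulZeta s = s * riemannZeta (s + 1) := by rw [mulZeta, if_neg hs]
      rw [h0, hM] at h
      have h2 : (2 : ℂ) ^ s * 2 ^ (-s) = 1 := by
        rw [← cpow_add _ _ two_ne_zero]; simp
      rw [hterm, tsum_neg, cpow_add _ _ two_ne_zero, cpow_one]
      linear_combination (-(2 : ℂ) ^ s) * h + s * riemannZeta (s + 1) * h2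
    refine ⟨?_, hmain, fun h2 => ?_⟩
    · rw [hterm]
      exact ((summable_nat_add_iff 1).2 hsum).neg
    · have h3 : s * ((2 : ℂ) ^ (s + 1) - 1) ≠ 0 := mul_ne_zero hs (sub_ne_zero.2 h2)
      rw [div_mul_eq_mul_div, ← hmain, mul_div_cancel_left₀ _ h3]
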